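/- **Theorem 4.3.** Let $0<T<\infty$, $a>0$, $b<0$, $\epsilon>0$, $\gamma\ge 0$ and $\beta\in\mathbb R$. Put $D=\,]a,\infty[$, $\Omega=\,]0,\infty[$, $B=[b-\epsilon,b]$, so that $\partial\Omega=\{0\}$. Let $f\in L^2(\mathbb R)$ be real valued with $\operatorname{supp} f\subset B$, and assume that for some $\mu\in\mathbb R$ $$\liminf_{\tau\to\infty}\tau^{\mu}\left|\int_{b-\epsilon}^b e^{-\tau(b-y)}f(y)\,dy\right|>0 .$$ Let $u$ be the weak solution of $$\partial_t^2u-\partial_x^2u=0\ \text{ in } ]-\infty,a[\,\times\,]0,T[,\qquad u(x,0)=0,\ \ \partial_tu(x,0)=f(x),$$ $$-\partial_xu(a,t)-\gamma\,\partial_tu(a,t)-\beta\,u(a,t)=0,\quad 0<t<T,$$ that is, $u\in C([0,T];V)\cap C^1([0,T];H)$ with $V=H^1(]-\infty,a[)$, $H=L^2(]-\infty,a[)$, the initial conditions hold, and for all $\phi\in V$ and $t\in[0,T]$ $$\frac{d}{dt}\Big(\int_{-\infty}^a\partial_tu(x,t)\,\phi(x)\,dx+\gamma\,u(a,t)\phi(a)\Big)+\int_{-\infty}^a\partial_xu(x,t)\,\phi'(x)\,dx+\beta\,u(a,t)\phi(a)=0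 .$$ (Elements of $V$ are identified with their continuous representatives on $]-\infty,a]$.) For $\tau>0$ let $$w(x,\tau)=\int_0^Te^{-\tau t}u(x,t)\,dt,\qquad v(x,\tau)=\frac1{2\tau}\int_{-\infty}^{\infty}e^{-\tau|x-y|}f(y)\,dy,$$ $$I(\tau)=-v'(0,\tau)w(0,\tau)+w'(0,\tau)v(0,\tau),$$ where $'=d/dx$. For every $\tau>0$ these quantities, and $\int_Bf(w-v)\,dy$, are well defined: the integral defining $w(x,\tau)$ converges for each $x\le a$, $w(\cdot,\tau)$ and $v(\cdot,\tau)$ are differentiable at $0$, and $f(w-v)$ is integrable on $B$. Moreover: (i) If $T>2\,\mathrm{dist}(D,B)-\mathrm{dist}(\Omega,B)$, then, as $\tau\to\infty$, one has the complete asymptotic expansion (in the sense of Poincaré) $$\frac{e^{2\tau\,\mathrm{dist}(D,B)}\,I(\tau)}{\left|\int_{b-\epsilon}^be^{-\tau(b-y)}f(y)\,dy\right|^2}\sim-\frac{\gamma-1}{2(\gamma+1)}\frac1\tau-\frac{\beta}{(\gamma+1)^2}\sum_{n=0}^\infty\Big(-\frac{\beta}{\gamma+1}\Big)^n\frac1{\tau^{n+2}}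 .$$ (ii) If $T>2\,\mathrm{dist}(D,B)$, then, as $\tau\to\infty$, the function $$\tau\longmapsto\frac{e^{2\tau\,\mathrm{dist}(D,B)}\int_Bf(w-v)\,dy}{\left|\int_{b-\epsilon}^be^{-\tau(b-y)}f(y)\,dy\right|^2}$$ has the same complete asymptotic expansion. In both cases $\gamma$ and $\beta$ can be recovered from the normalized function, call it $F(\tau)$: the limits $c_1=\lim_{\tau\to\infty}\tau F(\tau)$ and $c_2=\lim_{\tau\to\infty}\tau^2\big(F(\tau)-c_1/\tau\big)$ exist, $1+2c_1\neq0$, and $$\gamma=\frac{1-2c_1}{1+2c_1},\qquad \beta=-(\gamma+1)^2c_2 .$$ -/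

import Mathlib

open MeasureTheory Set Filter Topology Asymptotics

noncomputable section

/-- The distance between two sets of real numbers. -/
def setDist (A B : Set ℝ) : ℝ :=
  sInf {r : ℝ | ∃ x ∈ A, ∃ y ∈ B, r = dist x y}

/-- The unknown obstacle `D = ]a, ∞[`. -/
def obstacle (a : ℝ) : Set ℝ := Ioi a

/-- The domain `Ω = ]0, ∞[`, at whose boundary point `0` the wave is observed. -/
def domainOmega : Set ℝ := Ioi 0

/-- The interval `B = [b - ε, b]`, which carries the initial data. -/
def sourceB (b ε : ℝ) : Set ℝ := Icc (b - ε) b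

/-- Lebesgue measure on the half-line `]-∞, a[`. -/
abbrev halfLineMeasure (a : ℝ) : Measure ℝ := volume.restrict (Iio a)

/-- The real space `L²(]-∞, a[)`. -/
abbrev L2HalfLine (a : ℝ) : Type := Lp ℝ 2 (halfLineMeasure a)

/-- `g` is the representative, (absolutely) continuous up to the boundary point `a`, of an element
of the Sobolev space `V = H¹(]-∞, a[)`, and `g'` is its weak derivative. In particular `g a` is
the boundary trace of this element. -/
structure IsH1HalfLine (a : ℝ) (g g' : ℝ → ℝ) : Prop where
  memLp : MemLp g 2 (halfLineMeasure a)
  memLp_deriv : MemLp g' 2 (halfLineMeasure a)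
  sub_eq_integral : ∀ x ≤ a, ∀ y ≤ a, g y - g x = ∫ z in x..y, g' z

/-- `u` (as a function of `x` and `t`) is a weak solution of
`∂ₜ²u - ∂ₓ²u = 0` in `]-∞, a[ × ]0, T[`, `u(x, 0) = 0`, `∂ₜu(x, 0) = f(x)`,
`-∂ₓu(a, t) - γ ∂ₜu(a, t) - β u(a, t) = 0` for `0 < t < T`.
It is of finite energy, that is, in `C([0, T]; V) ∩ C¹([0, T]; L²)`, and for every `φ ∈ V` and
`t ∈ [0, T]`
`d/dt ((∂ₜu(t), φ) + γ u(a, t) φ(a)) + (∂ₓu(t), φ') + β u(a, t) φ(a) = 0`.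
The curves `U`, `Ux`, `Ut` are `u`, `∂ₓu`, `∂ₜu` as curves in `L²(]-∞, a[)`. -/
def IsWeakSolution (a T γ β : ℝ) (f : ℝ → ℝ) (u : ℝ → ℝ → ℝ) : Prop :=
  ∃ U Ux Ut : ℝ → L2HalfLine a,
    (∀ t ∈ Icc 0 T, U t =ᵐ[halfLineMeasure a] fun x => u x t) ∧
    (∀ t ∈ Icc 0 T, IsH1HalfLine a (fun x => u x t) (Ux t)) ∧
    ContinuousOn U (Icc 0 T) ∧
    ContinuousOn Ux (Icc 0 T) ∧
    ContinuousOn Ut (Icc 0 T) ∧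
    (∀ t ∈ Icc 0 T, HasDerivWithinAt U (Ut t) (Icc 0 T) t) ∧
    (∀ x ≤ a, u x 0 = 0) ∧
    Ut 0 =ᵐ[halfLineMeasure a] f ∧
    ∀ φ φ' : ℝ → ℝ, IsH1HalfLine a φ φ' → ∀ t ∈ Icc 0 T,
      HasDerivWithinAt (fun s => (∫ x in Iio a, Ut s x * φ x) + γ * u a s * φ a)
        (-((∫ x in Iio a, Ux t x * φ' x) + β * u a t * φ a)) (Icc 0 T) t

/-- `w(x, τ) = ∫₀ᵀ e^{-τ t} u(x, t) dt`. -/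
def waveLaplace (T : ℝ) (u : ℝ → ℝ → ℝ) (x τ : ℝ) : ℝ :=
  ∫ t in (0 : ℝ)..T, Real.exp (-τ * t) * u x t

/-- `v(x, τ) = (1 / (2τ)) ∫ e^{-τ |x - y|} f(y) dy`. -/
def freeField (f : ℝ → ℝ) (x τ : ℝ) : ℝ :=
  1 / (2 * τ) * ∫ y, Real.exp (-τ * |x - y|) * f y

/-- The indicator function `I(τ) = -v'(0, τ) w(0, τ) + w'(0, τ) v(0, τ)`. -/
def indicatorI (T : ℝ) (f : ℝ → ℝ) (u : ℝ → ℝ → ℝ) (τ : ℝ) : ℝ :=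
  -deriv (fun x => freeField f x τ) 0 * waveLaplace T u 0 τ +
    deriv (fun x => waveLaplace T u x τ) 0 * freeField f 0 τ

/-- The back-scattering quantity `∫_B f (w - v) dy`. -/
def backScattering (b ε T : ℝ) (f : ℝ → ℝ) (u : ℝ → ℝ → ℝ) (τ : ℝ) : ℝ :=
  ∫ y in sourceB b ε, f y * (waveLaplace T u y τ - freeField f y τ)

/-- `∫_{b-ε}^b e^{-τ (b - y)} f(y) dy`. -/
def sourceIntegral (b ε : ℝ) (f : ℝ → ℝ) (τ : ℝ) : ℝ :=
  ∫ y in (b - ε)..b, Real.exp (-τ * (b - y)) * f y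

/-- `liminf_{τ → ∞} τ^μ |∫_{b-ε}^b e^{-τ (b - y)} f(y) dy| > 0` for some real `μ`. The lower limit
is taken in `[0, ∞]`. -/
def NonvanishingAtEndpoint (b ε : ℝ) (f : ℝ → ℝ) : Prop :=
  ∃ μ : ℝ, 0 < liminf (fun τ : ℝ => ENNReal.ofReal (τ ^ μ * |sourceIntegral b ε f τ|)) atTop

/-- A function `J` of `τ`, multiplied by `e^{2τ dist(D, B)}` and divided by
`|∫_{b-ε}^b e^{-τ (b - y)} f(y) dy|²`. -/
def normalized (a b ε : ℝ) (f : ℝ → ℝ) (J : ℝ → ℝ) (τ : ℝ) : ℝ :=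
  Real.exp (2 * τ * setDist (obstacle a) (sourceB b ε)) * J τ / |sourceIntegral b ε f τ| ^ 2

/-- Complete asymptotic expansion `F(τ) ∼ ∑ k, c k / τ ^ k` as `τ → ∞`, in the sense of
Poincaré. -/
def HasAsymptoticExpansion (F : ℝ → ℝ) (c : ℕ → ℝ) : Prop :=
  ∀ N : ℕ, (fun τ => F τ - ∑ k ∈ Finset.range N, c k / τ ^ k) =O[atTop] fun τ => 1 / τ ^ N

/-- The coefficients of
`-(γ - 1) / (2 (γ + 1)) τ⁻¹ - β / (γ + 1)² ∑ n, (-β / (γ + 1)) ^ n τ ^ (-n - 2)`. -/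
def expansionCoeff (γ β : ℝ) : ℕ → ℝ
  | 0 => 0
  | 1 => -((γ - 1) / (2 * (γ + 1)))
  | n + 2 => -(β / (γ + 1) ^ 2) * (-β / (γ + 1)) ^ n

/-- The numbers `γ` and `β` are recovered from the behaviour of `F` at infinity: the limits
`c₁ = lim τ F(τ)` and `c₂ = lim τ² (F(τ) - c₁ / τ)` exist, and they give first `γ`, then `β`. -/
def RecoversParameters (F : ℝ → ℝ) (γ β : ℝ) : Prop :=
  ∃ c₁ c₂ : ℝ, Tendsto (fun τ => τ * F τ) atTop (𝓝 c₁) ∧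
    Tendsto (fun τ => τ ^ 2 * (F τ - c₁ / τ)) atTop (𝓝 c₂) ∧
    1 + 2 * c₁ ≠ 0 ∧ γ = (1 - 2 * c₁) / (1 + 2 * c₁) ∧ β = -(γ + 1) ^ 2 * c₂

end

/-
Truncating the Laplace transform at `T` and testing the weak formulation with `e^{-τ|x - y|}`
expresses `2τ (w - v)` as an echo `A(τ) e^{-τ(a - x)}` from the boundary point, up to a term that
carries the factor `e^{-τT}` and the state of finite energy at time `T`. At `x = a` this is a linear
equation for the trace `w(a, τ)`, which gives `A(τ) = R(τ) e^{-τ(a - b)} S(τ)` up to such a term.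
Here `S` is the integral of `e^{-τ(b - y)} f(y)` over the source and
`R(τ) = ((1 - γ)τ - β) / ((1 + γ)τ + β)` is the reflection coefficient of the boundary condition.
So both data functions equal `R(τ) / (2τ) · e^{-2τ dist(D, B)} S(τ)²` up to errors which, under the
respective lower bound for `T`, are exponentially small relative to it, as `S` decays at most
algebraically. Expanding `R` into a geometric series gives the coefficients.
-/

/-- The decaying exponential `e^{-τ |x - y|}`, which is `2τ` times the free-space Green function
of `τ² - ∂²`. -/
noncomputable def expKernel (τ x y : ℝ) : ℝ := Real.exp (-τ * |x - y|)

/-- The derivative of `expKernel τ x y` in `y`, with the value `0` at the kink `y = x`. -/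
noncomputable def expKernelDeriv (τ x y : ℝ) : ℝ := τ * SignType.sign (x - y) * expKernel τ x y

section Kernel

variable {τ x x₀ y r : ℝ}

lemma continuous_expKernel : Continuous (expKernel τ x) := by
  unfold expKernel
  fun_prop

lemma expKernel_pos : 0 < expKernel τ x y := Real.exp_pos _

lemma expKernel_self : expKernel τ x x = 1 := by simp [expKernel]

lemma expKernel_comm : expKernel τ x y = expKernel τ y x := by
  rw [expKernel, expKernel, abs_sub_comm]

lemma expKernel_of_le (h : y ≤ x) : expKernel τ x y = Real.exp (-τ * (x - y)) := by
  rw [expKernel, abs_of_nonneg (sub_nonneg.2 h)]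

lemma expKernel_of_ge (h : x ≤ y) : expKernel τ x y = Real.exp (-τ * (y - x)) := by
  rw [expKernel_comm, expKernel_of_le h]

lemma expKernel_antitone (h : r ≤ τ) : expKernel τ x y ≤ expKernel r x y :=
  Real.exp_le_exp.2 (mul_le_mul_of_nonneg_right (neg_le_neg h) (abs_nonneg _))

lemma expKernel_le_exp_mul (hτ : 0 ≤ τ) :
    expKernel τ x y ≤ Real.exp (τ * |x - x₀|) * expKernel τ x₀ y := by
  rw [expKernel, expKernel, ← Real.exp_add]
  have h : |x₀ - y| ≤ |x - x₀| + |x - y| := abs_sub_comm x x₀ ▸ abs_sub_le _ _ _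
  exact Real.exp_le_exp.2 (by nlinarith)

lemma expKernel_sub_le (hτ : 0 ≤ τ) :
    expKernel τ x y - expKernel τ x₀ y ≤ expKernel τ x y * (τ * |x - x₀|) := by
  have h : expKernel τ x y * (1 - τ * |x - x₀|) ≤ expKernel τ x₀ y :=
    calc expKernel τ x y * (1 - τ * |x - x₀|)
        ≤ expKernel τ x y * Real.exp (-(τ * |x - x₀|)) :=
          mul_le_mul_of_nonneg_left (Real.one_sub_le_exp_neg _) expKernel_pos.le
      _ ≤ expKernel τ x₀ y := by
          have hmul := expKernel_le_exp_mul (x := x) (x₀ := x₀) (y := y) hτ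
          rwa [Real.exp_neg, ← div_eq_mul_inv, div_le_iff₀' (Real.exp_pos _)]
  linarith

lemma abs_expKernel_sub_le (hτ : 0 ≤ τ) {p q : ℝ} (hp : |p - x₀| ≤ r) (hq : |q - x₀| ≤ r) :
    |expKernel τ p y - expKernel τ q y| ≤
      τ * (Real.exp (τ * r) * expKernel τ x₀ y) * |p - q| := by
  have hle : ∀ z, |z - x₀| ≤ r → expKernel τ z y ≤ Real.exp (τ * r) * expKernel τ x₀ y :=
    fun z hz => (expKernel_le_exp_mul hτ).trans
      (mul_le_mul_of_nonneg_right (by gcongr) expKernel_pos.le)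
  have hdist : 0 ≤ τ * |p - q| := by positivity
  have hpq := (expKernel_sub_le (y := y) hτ).trans (mul_le_mul_of_nonneg_right (hle p hp) hdist)
  have hqp := (expKernel_sub_le (y := y) hτ).trans
    (mul_le_mul_of_nonneg_right (hle q hq) (abs_sub_comm p q ▸ hdist))
  rw [abs_sub_comm q p] at hqp
  exact abs_le.2 ⟨by linarith, by linarith⟩

lemma measurable_expKernelDeriv : Measurable (expKernelDeriv τ x) := by
  have hmono : Monotone fun s : SignType => (s : ℝ) := by
    rintro (_ | _ | _) (_ | _ | _) h <;> first | exact absurd h (by decide) | simp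
  have hsign : Measurable fun y : ℝ => (SignType.sign (x - y) : ℝ) :=
    (hmono.comp SignType.sign.monotone).measurable.comp (measurable_const.sub measurable_id)
  exact (hsign.const_mul τ).mul continuous_expKernel.measurable

lemma abs_expKernelDeriv_le (hτ : 0 ≤ τ) : |expKernelDeriv τ x y| ≤ τ * expKernel τ x y := by
  rw [expKernelDeriv, abs_mul, abs_mul, abs_of_nonneg hτ, abs_of_pos expKernel_pos]
  have hsign : |(SignType.sign (x - y) : ℝ)| ≤ 1 := by
    cases SignType.sign (x - y) <;> simp
  exact mul_le_mul_of_nonneg_right (mul_le_of_le_one_right hτ hsign) expKernel_pos.le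

lemma expKernelDeriv_swap : expKernelDeriv τ y x = -expKernelDeriv τ x y := by
  rw [expKernelDeriv, expKernelDeriv, expKernel_comm, ← neg_sub x y, Left.sign_neg]
  push_cast
  ring

lemma hasDerivAt_expKernel (h : y ≠ x) :
    HasDerivAt (expKernel τ x) (expKernelDeriv τ x y) y := by
  have hsub : HasDerivAt (fun y => x - y) (-1) y := (hasDerivAt_id y).const_sub x
  have habs := (hasDerivAt_abs (sub_ne_zero.2 h.symm)).comp y hsub
  refine (habs.const_mul (-τ)).exp.congr_deriv ?_
  simp only [expKernelDeriv, expKernel, Function.comp_apply]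
  ring

lemma integrable_expKernel (hτ : 0 < τ) : Integrable (expKernel τ x) := by
  rw [← integrableOn_univ, ← Iic_union_Ioi (a := x)]
  refine .union ?_ ?_
  · refine IntegrableOn.congr_fun
      ((integrableOn_exp_mul_Iic hτ x).const_mul (Real.exp (-τ * x))) (fun y hy => ?_)
      measurableSet_Iic
    rw [expKernel_of_le hy, ← Real.exp_add]
    ring_nf
  · refine IntegrableOn.congr_fun
      ((integrableOn_exp_mul_Ioi (neg_lt_zero.2 hτ) x).const_mul (Real.exp (τ * x)))
      (fun y hy => ?_) measurableSet_Ioi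
    rw [expKernel_of_ge (le_of_lt hy), ← Real.exp_add]
    ring_nf

lemma memLp_expKernel (hτ : 0 < τ) : MemLp (expKernel τ x) 2 := by
  rw [memLp_two_iff_integrable_sq continuous_expKernel.aestronglyMeasurable]
  refine (integrable_expKernel (τ := 2 * τ) (x := x) (by positivity)).congr (.of_forall fun y => ?_)
  simp only [expKernel, ← Real.exp_nat_mul]
  push_cast
  ring_nf

lemma memLp_expKernelDeriv (hτ : 0 < τ) : MemLp (expKernelDeriv τ x) 2 := by
  refine ((memLp_expKernel (x := x) hτ).const_mul τ).mono
    measurable_expKernelDeriv.aestronglyMeasurable (.of_forall fun y => ?_)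
  rw [Real.norm_eq_abs, Real.norm_of_nonneg (mul_pos hτ expKernel_pos).le]
  exact abs_expKernelDeriv_le hτ.le

lemma isH1HalfLine_expKernel (hτ : 0 < τ) (a : ℝ) :
    IsH1HalfLine a (expKernel τ x) (expKernelDeriv τ x) where
  memLp := (memLp_expKernel hτ).restrict _
  memLp_deriv := (memLp_expKernelDeriv hτ).restrict _
  sub_eq_integral p _ q _ := by
    have hint : IntervalIntegrable (expKernelDeriv τ x) volume p q :=
      (((memLp_expKernelDeriv hτ).locallyIntegrable one_le_two).integrableOn_isCompact
        isCompact_uIcc).intervalIntegrable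
    exact (integral_eq_of_hasDerivAt_off_countable _ _ (countable_singleton x)
      continuous_expKernel.continuousOn (fun y hy => hasDerivAt_expKernel hy.2) hint).symm

end Kernel

section Potential

variable {μ : Measure ℝ} {P : ℝ → ℝ} {τ x x₀ : ℝ}

lemma integrable_mul_expKernel (hτ : 0 < τ) {s : Set ℝ} (hP : MemLp P 2 (volume.restrict s)) :
    Integrable (fun y => P y * expKernel τ x y) (volume.restrict s) :=
  hP.integrable_mul ((memLp_expKernel hτ).restrict s)

lemma hasDerivAt_integral_mul_expKernel [NullSingletonClass μ] (hτ : 0 ≤ τ)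
    (hP : AEStronglyMeasurable P μ) (hint : Integrable (fun y => P y * expKernel τ x₀ y) μ) :
    HasDerivAt (fun x => ∫ y, P y * expKernel τ x y ∂μ)
      (-∫ y, P y * expKernelDeriv τ x₀ y ∂μ) x₀ := by
  rw [← integral_neg]
  refine (hasDerivAt_integral_of_dominated_loc_of_lip (𝕜 := ℝ)
    (bound := fun y => τ * Real.exp (τ * 1) * |P y * expKernel τ x₀ y|)
    (Metric.closedBall_mem_nhds x₀ one_pos) ?_ hint ?_ ?_ ?_ ?_).2
  · exact .of_forall fun x => hP.mul continuous_expKernel.aestronglyMeasurable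
  · exact (hP.mul measurable_expKernelDeriv.aestronglyMeasurable).neg
  · refine .of_forall fun y => .of_dist_le_mul fun p hp q hq => ?_
    rw [Real.coe_nnabs, abs_of_nonneg (by positivity), Real.dist_eq, Real.dist_eq, ← mul_sub,
      abs_mul, abs_mul, abs_of_pos (expKernel_pos (x := x₀))]
    have hker := abs_expKernel_sub_le (y := y) hτ (mem_closedBall_iff_norm.1 hp)
      (mem_closedBall_iff_norm.1 hq)
    calc |P y| * |expKernel τ p y - expKernel τ q y|
        ≤ |P y| * (τ * (Real.exp (τ * 1) * expKernel τ x₀ y) * |p - q|) := by gcongr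
      _ = _ := by ring
  · exact hint.abs.const_mul _
  · filter_upwards [compl_mem_ae_iff.2 (measure_singleton x₀)] with y hy
    have hderiv := (hasDerivAt_expKernel (τ := τ) (Ne.symm hy)).const_mul (P y)
    rw [expKernelDeriv_swap, mul_neg] at hderiv
    simpa only [expKernel_comm (x := y)] using hderiv

end Potential

section HalfLine

variable {a τ x : ℝ} {g g' : ℝ → ℝ}

lemma intervalIntegrable_of_memLp_halfLine {p q : ℝ} (hp : p ≤ a) (hq : q ≤ a)
    (hg : MemLp g 2 (halfLineMeasure a)) : IntervalIntegrable g volume p q := by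
  rw [halfLineMeasure, restrict_Iio_eq_restrict_Iic] at hg
  have hsub : uIoc p q ⊆ Iic a := fun y hy => hy.2.trans (max_le hp hq)
  have hpq : MemLp g 2 (volume.restrict (uIoc p q)) :=
    hg.mono_measure (Measure.restrict_mono hsub le_rfl)
  have : IsFiniteMeasure (volume.restrict (uIoc p q)) := ⟨by simp [uIoc]⟩
  exact intervalIntegrable_iff.2 (hpq.integrable one_le_two)

lemma integral_deriv_add_mul_exp {p q : ℝ} (k : ℝ) (hint : IntervalIntegrable g' volume p q)
    (hg : ∀ y ∈ uIcc p q, g y - g p = ∫ z in p..y, g' z) :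
    ∫ y in p..q, (g' y + k * g y) * Real.exp (k * y) =
      g q * Real.exp (k * q) - g p * Real.exp (k * p) := by
  set H : ℝ → ℝ := fun y => (g p + ∫ z in p..y, g' z) * Real.exp (k * y) with hH
  have hHg : ∀ y ∈ uIcc p q, H y = g y * Real.exp (k * y) := fun y hy => by
    simp only [hH, ← hg y hy, add_sub_cancel]
  have hHac : AbsolutelyContinuousOnInterval H p q := by
    have hconst : AbsolutelyContinuousOnInterval (fun _ => g p) p q :=
      ContDiffOn.absolutelyContinuousOnInterval contDiffOn_const
    have hexp : AbsolutelyContinuousOnInterval (fun y => Real.exp (k * y)) p q :=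
      ContDiffOn.absolutelyContinuousOnInterval (by fun_prop)
    have hprim := hint.absolutelyContinuousOnInterval_intervalIntegral left_mem_uIcc
    exact (hconst.fun_add hprim).fun_mul hexp
  rw [← hHg q right_mem_uIcc, ← hHg p left_mem_uIcc, ← hHac.integral_deriv_eq_sub]
  refine intervalIntegral.integral_congr_ae ?_
  filter_upwards [hint.ae_hasDerivAt_integral] with y hy hypq
  have hyI := uIoc_subset_uIcc hypq
  have hexp : HasDerivAt (fun y => Real.exp (k * y)) (Real.exp (k * y) * (k * 1)) y :=
    ((hasDerivAt_id y).const_mul k).exp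
  refine (((hy hyI p left_mem_uIcc).const_add (g p)).fun_mul hexp).deriv.trans ?_ |>.symm
  rw [← hg y hyI]
  ring

namespace IsH1HalfLine

lemma integral_deriv_add_mul_exp (h : IsH1HalfLine a g g') (k : ℝ) {p q : ℝ} (hp : p ≤ a)
    (hq : q ≤ a) : ∫ y in p..q, (g' y + k * g y) * Real.exp (k * y) =
      g q * Real.exp (k * q) - g p * Real.exp (k * p) :=
  _root_.integral_deriv_add_mul_exp k (intervalIntegrable_of_memLp_halfLine hp hq h.memLp_deriv)
    fun y hy => h.sub_eq_integral p hp y (hy.2.trans (max_le hp hq))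

lemma mono (h : IsH1HalfLine a g g') (hx : x ≤ a) : IsH1HalfLine x g g' where
  memLp := h.memLp.mono_measure (Measure.restrict_mono (Iio_subset_Iio hx) le_rfl)
  memLp_deriv := h.memLp_deriv.mono_measure (Measure.restrict_mono (Iio_subset_Iio hx) le_rfl)
  sub_eq_integral p hp q hq := h.sub_eq_integral p (hp.trans hx) q (hq.trans hx)

lemma integral_Iic_deriv_add_mul_exp (h : IsH1HalfLine x g g') (hτ : 0 < τ) :
    ∫ y in Iic x, (g' y + τ * g y) * Real.exp (τ * y) = g x * Real.exp (τ * x) := by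
  have hint : ∀ {G : ℝ → ℝ}, MemLp G 2 (halfLineMeasure x) →
      IntegrableOn (fun y => G y * Real.exp (τ * y)) (Iic x) := fun {G} hG => by
    rw [halfLineMeasure, restrict_Iio_eq_restrict_Iic] at hG
    refine IntegrableOn.congr_fun ((integrable_mul_expKernel (x := x) hτ hG).const_mul
      (Real.exp (τ * x))) (fun y hy => ?_) measurableSet_Iic
    rw [expKernel_of_le hy, mul_left_comm, ← Real.exp_add]
    ring_nf
  have hlim := (intervalIntegral_tendsto_integral_Iic x
    (hint (h.memLp_deriv.add (h.memLp.const_mul τ))) tendsto_id).const_sub (g x * Real.exp (τ * x))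
  have hbot : Tendsto (fun p => g p * Real.exp (τ * p)) atBot
      (𝓝 (g x * Real.exp (τ * x) - ∫ y in Iic x, (g' y + τ * g y) * Real.exp (τ * y))) := by
    refine hlim.congr' ?_
    filter_upwards [eventually_le_atBot x] with p hp
    exact (congrArg _ (h.integral_deriv_add_mul_exp τ hp le_rfl)).trans (sub_sub_cancel _ _)
  -- `g e^{τ ·}` has a limit at `-∞` and is integrable there, so the limit is `0`.
  have hzero := IntegrableAtFilter.eq_zero_of_tendsto (μ := volume)
    ⟨Iic x, Iic_mem_atBot x, hint h.memLp⟩ (fun s hs => by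
      obtain ⟨r, hr⟩ := mem_atBot_sets.1 hs
      exact measure_mono_top (s₁ := Iic r) (fun y hy => hr y hy) Real.volume_Iic) hbot
  exact (sub_eq_zero.1 hzero).symm

lemma integral_Iio_mul_expKernel (h : IsH1HalfLine x g g') (hτ : 0 < τ) :
    ∫ y in Iio x, (g' y + τ * g y) * expKernel τ x y = g x := by
  refine mul_right_cancel₀ (Real.exp_pos (τ * x)).ne' ?_
  rw [← h.integral_Iic_deriv_add_mul_exp hτ, restrict_Iio_eq_restrict_Iic, ← integral_mul_const]
  refine setIntegral_congr_fun measurableSet_Iic fun y hy => ?_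
  rw [expKernel_of_le hy, mul_assoc, ← Real.exp_add]
  ring_nf

lemma intervalIntegral_mul_expKernel (h : IsH1HalfLine a g g') (hx : x ≤ a) :
    ∫ y in x..a, (-g' y + τ * g y) * expKernel τ x y = g x - g a * expKernel τ x a := by
  refine mul_right_cancel₀ (Real.exp_pos (-τ * x)).ne' ?_
  have hker : ∀ y, x ≤ y → expKernel τ x y * Real.exp (-τ * x) = Real.exp (-τ * y) :=
    fun y hy => by
      rw [expKernel_of_ge hy, ← Real.exp_add]
      ring_nf
  rw [sub_mul, mul_assoc, hker a hx, ← neg_sub (g a * _),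
    ← h.integral_deriv_add_mul_exp (-τ) hx le_rfl, ← intervalIntegral.integral_mul_const,
    ← intervalIntegral.integral_neg]
  refine intervalIntegral.integral_congr fun y hy => ?_
  rw [uIcc_of_le hx] at hy
  rw [mul_assoc, hker y hy.1]
  ring

/-- `expKernel τ x / (2 τ)` reproduces values at `x`, up to a boundary term at `a`. -/
lemma integral_deriv_mul_expKernelDeriv_add (h : IsH1HalfLine a g g') (hτ : 0 < τ)
    (hx : x ≤ a) :
    (∫ y in Iio a, g' y * expKernelDeriv τ x y) + τ ^ 2 * ∫ y in Iio a, g y * expKernel τ x y =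
      2 * τ * g x - τ * expKernel τ x a * g a := by
  have hderiv : Integrable (fun y => g' y * expKernelDeriv τ x y) (halfLineMeasure a) :=
    h.memLp_deriv.integrable_mul ((memLp_expKernelDeriv hτ).restrict _)
  have hmul := (integrable_mul_expKernel (x := x) hτ h.memLp).const_mul (τ ^ 2)
  have hint : IntegrableOn
      (fun y => g' y * expKernelDeriv τ x y + τ ^ 2 * (g y * expKernel τ x y)) (Iio a) :=
    hderiv.add hmul
  have hleft : ∫ y in Iio x, (g' y * expKernelDeriv τ x y + τ ^ 2 * (g y * expKernel τ x y)) =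
      τ * ∫ y in Iio x, (g' y + τ * g y) * expKernel τ x y := by
    rw [← integral_const_mul]
    refine setIntegral_congr_fun measurableSet_Iio fun y hy => ?_
    simp only [expKernelDeriv, sign_pos (sub_pos.2 (mem_Iio.1 hy)), SignType.coe_one]
    ring
  have hright : ∫ y in Ico x a, (g' y * expKernelDeriv τ x y + τ ^ 2 * (g y * expKernel τ x y)) =
      τ * ∫ y in x..a, (-g' y + τ * g y) * expKernel τ x y := by
    rw [integral_Ico_eq_integral_Ioo, intervalIntegral.integral_of_le hx,
      integral_Ioc_eq_integral_Ioo, ← integral_const_mul]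
    refine setIntegral_congr_fun measurableSet_Ioo fun y hy => ?_
    simp only [expKernelDeriv, sign_neg (sub_neg.2 hy.1), SignType.coe_neg_one]
    ring
  have hdisj : Disjoint (Iio x) (Ico x a) :=
    (Iio_disjoint_Ici le_rfl).mono_right Ico_subset_Ici_self
  rw [← integral_const_mul, ← integral_add hderiv hmul, halfLineMeasure,
    ← Iio_union_Ico_eq_Iio hx,
    setIntegral_union hdisj measurableSet_Ico (hint.mono_set (Iio_subset_Iio hx))
      (hint.mono_set Ico_subset_Iio_self), hleft, hright,
    (h.mono hx).integral_Iio_mul_expKernel hτ, h.intervalIntegral_mul_expKernel hx]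
  ring

end IsH1HalfLine

end HalfLine

section Pairing

variable {α : Type*} [MeasurableSpace α] {μ : Measure α} {φ : α → ℝ} {s : Set ℝ}

lemma integral_mul_eq_inner (hφ : MemLp φ 2 μ) (P : Lp ℝ 2 μ) :
    ∫ y, P y * φ y ∂μ = inner ℝ (hφ.toLp φ) P := by
  rw [L2.inner_def]
  refine integral_congr_ae ?_
  filter_upwards [hφ.coeFn_toLp] with y hy
  simp [hy]

lemma continuousOn_integral_mul (hφ : MemLp φ 2 μ) {P : ℝ → Lp ℝ 2 μ} (hP : ContinuousOn P s) :
    ContinuousOn (fun t => ∫ y, P t y * φ y ∂μ) s := by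
  simp only [integral_mul_eq_inner hφ]
  exact (innerSL ℝ (hφ.toLp φ)).continuous.comp_continuousOn hP

lemma hasDerivWithinAt_integral_mul (hφ : MemLp φ 2 μ) {P : ℝ → Lp ℝ 2 μ} {P' : Lp ℝ 2 μ} {t : ℝ}
    (hP : HasDerivWithinAt P P' s t) :
    HasDerivWithinAt (fun t => ∫ y, P t y * φ y ∂μ) (∫ y, P' y * φ y ∂μ) s t := by
  simp only [integral_mul_eq_inner hφ]
  simpa using (hasDerivWithinAt_const t s (hφ.toLp φ)).inner ℝ hP

end Pairing

section WeakSolution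

variable {a T γ β τ x : ℝ} {f p q : ℝ → ℝ} {u : ℝ → ℝ → ℝ}

lemma IsWeakSolution.continuousOn (hu : IsWeakSolution a T γ β f u) (hx : x ≤ a) :
    ContinuousOn (u x) (Icc 0 T) := by
  obtain ⟨U, Ux, -, hU, hH, hUc, hUxc, -⟩ := hu
  have hφ : MemLp ((Iio x).indicator (expKernel 1 x)) 2 (halfLineMeasure a) :=
    ((memLp_expKernel one_pos).indicator measurableSet_Iio).restrict _
  refine (continuousOn_integral_mul hφ (hUxc.add hUc)).congr fun t ht => ?_
  -- The trace at `x` is the pairing with an exponential supported to the left of `x`.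
  have hsub : Iio a ∩ Iio x = Iio x := inter_eq_right.2 (Iio_subset_Iio hx)
  rw [← ((hH t ht).mono hx).integral_Iio_mul_expKernel one_pos]
  conv_lhs => rw [← hsub, ← setIntegral_indicator measurableSet_Iio]
  refine integral_congr_ae ?_
  filter_upwards [hU t ht, Lp.coeFn_add (Ux t) (U t)] with y hUy hadd
  rw [Pi.add_apply, hadd, Pi.add_apply, hUy]
  by_cases hyx : y ∈ Iio x <;> simp [hyx]

lemma IsWeakSolution.intervalIntegrable (hu : IsWeakSolution a T γ β f u) (hT : 0 ≤ T)
    (hx : x ≤ a) : IntervalIntegrable (fun t => Real.exp (-τ * t) * u x t) volume 0 T := by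
  refine ContinuousOn.intervalIntegrable ?_
  rw [uIcc_of_le hT]
  exact (Continuous.continuousOn (by fun_prop)).mul (hu.continuousOn hx)

lemma hasDerivWithinAt_exp_mul_tested {U Ut : ℝ → L2HalfLine a} {ux : ℝ → ℝ} {s : Set ℝ} {t : ℝ}
    (hτ : 0 < τ) (hx : x ≤ a) (hU : U t =ᵐ[halfLineMeasure a] fun y => u y t)
    (hH : IsH1HalfLine a (fun y => u y t) ux) (hUd : HasDerivWithinAt U (Ut t) s t)
    (hweak : HasDerivWithinAt
      (fun s => (∫ y in Iio a, Ut s y * expKernel τ x y) + γ * u a s * expKernel τ x a)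
      (-((∫ y in Iio a, ux y * expKernelDeriv τ x y) + β * u a t * expKernel τ x a)) s t) :
    HasDerivWithinAt
      (fun s => Real.exp (-τ * s) * ((∫ y in Iio a, Ut s y * expKernel τ x y) +
        γ * u a s * expKernel τ x a + τ * ∫ y in Iio a, U s y * expKernel τ x y))
      ((τ - γ * τ - β) * expKernel τ x a * (Real.exp (-τ * t) * u a t) -
        2 * τ * (Real.exp (-τ * t) * u x t)) s t := by
  have hUK := (hasDerivWithinAt_integral_mul (isH1HalfLine_expKernel (x := x) hτ a).memLp
    hUd).const_mul τ
  have hexp : HasDerivWithinAt (fun t => Real.exp (-τ * t)) (Real.exp (-τ * t) * (-τ * 1)) s t :=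
    ((hasDerivWithinAt_id t _).const_mul (-τ)).exp
  have hreproduce := hH.integral_deriv_mul_expKernelDeriv_add hτ hx
  have hUu : ∫ y in Iio a, U t y * expKernel τ x y = ∫ y in Iio a, u y t * expKernel τ x y :=
    integral_congr_ae (hU.mul .rfl)
  refine (hexp.mul (hweak.add hUK)).congr_deriv ?_
  simp only [Pi.add_apply, hUu]
  linear_combination (-Real.exp (-τ * t)) * hreproduce

/-- The potential of the final state `(∂ₜu, u) = (p, q)` at time `T`, which is what cutting the
Laplace transform off at `T` leaves behind. -/
noncomputable def terminalPotential (a : ℝ) (p q : ℝ → ℝ) (τ x : ℝ) : ℝ :=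
  ∫ y in Iio a, (p y + τ * q y) * expKernel τ x y

lemma terminalPotential_eq (hτ : 0 < τ) (hp : MemLp p 2 (halfLineMeasure a))
    (hq : MemLp q 2 (halfLineMeasure a)) : terminalPotential a p q τ x =
      (∫ y in Iio a, p y * expKernel τ x y) + τ * ∫ y in Iio a, q y * expKernel τ x y := by
  rw [← integral_const_mul, ← integral_add (integrable_mul_expKernel hτ hp)
    ((integrable_mul_expKernel hτ hq).const_mul τ)]
  exact integral_congr_ae (.of_forall fun y => by ring)

/-- The amplitude of the wave which the boundary point `a` sends back. -/
noncomputable def echoAmplitude (a T γ β : ℝ) (u : ℝ → ℝ → ℝ) (τ : ℝ) : ℝ :=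
  (τ - γ * τ - β) * waveLaplace T u a τ - Real.exp (-τ * T) * (γ * u a T)

/-- The scattered field `w - v` is the echo from `a` minus the potential of the final state
`(p, q)`, both divided by `2 τ`. -/
structure HasScatteredField (a T γ β : ℝ) (f : ℝ → ℝ) (u : ℝ → ℝ → ℝ) (p q : ℝ → ℝ) : Prop where
  memLp_velocity : MemLp p 2 (halfLineMeasure a)
  memLp_position : MemLp q 2 (halfLineMeasure a)
  waveLaplace_eq : ∀ τ, 0 < τ → ∀ x ≤ a, waveLaplace T u x τ = freeField f x τ +
    1 / (2 * τ) * (echoAmplitude a T γ β u τ * expKernel τ x a -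
      Real.exp (-τ * T) * terminalPotential a p q τ x)

lemma setIntegral_mul_expKernel {s : Set ℝ} (hsupp : ∀ᵐ y, y ∉ s → f y = 0) (hτ : τ ≠ 0) :
    ∫ y in s, f y * expKernel τ x y = 2 * τ * freeField f x τ := by
  rw [setIntegral_eq_integral_of_ae_compl_eq_zero, freeField, ← mul_assoc, mul_one_div_cancel
    (by positivity), one_mul]
  · simp only [expKernel, mul_comm]
  · filter_upwards [hsupp] with y hy hys
    rw [hy hys, zero_mul]

lemma IsWeakSolution.exists_hasScatteredField (hu : IsWeakSolution a T γ β f u) (hT : 0 ≤ T)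
    (hsupp : ∀ᵐ x, x ∉ Iio a → f x = 0) : ∃ p q, HasScatteredField a T γ β f u p q := by
  have hint := fun (x : ℝ) (hx : x ≤ a) (τ : ℝ) => hu.intervalIntegrable (τ := τ) hT hx
  obtain ⟨U, Ux, Ut, hU, hH, -, -, -, hUd, hu0, hUt0, hweak⟩ := hu
  refine ⟨Ut T, U T, Lp.memLp _, Lp.memLp _, fun τ hτ x hx => ?_⟩
  have hK := isH1HalfLine_expKernel (x := x) hτ a
  have hderiv := fun t ht => hasDerivWithinAt_exp_mul_tested hτ hx (hU t ht) (hH t ht) (hUd t ht)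
    (hweak _ _ hK t ht)
  have hftc := intervalIntegral.integral_eq_sub_of_hasDerivAt_of_le hT
    (fun t ht => (hderiv t ht).continuousWithinAt)
    (fun t ht => (hderiv t (Ioo_subset_Icc_self ht)).hasDerivAt (Icc_mem_nhds ht.1 ht.2))
    (((hint a le_rfl τ).const_mul _).sub ((hint x hx τ).const_mul _))
  have hinitial : ∫ y in Iio a, U 0 y * expKernel τ x y = 0 := by
    refine integral_eq_zero_of_ae ?_
    filter_upwards [hU 0 (left_mem_Icc.2 hT), ae_restrict_mem measurableSet_Iio] with y hy hya
    rw [hy, hu0 y (le_of_lt hya), zero_mul, Pi.zero_apply]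
  have hsource : ∫ y in Iio a, Ut 0 y * expKernel τ x y = 2 * τ * freeField f x τ :=
    (integral_congr_ae (hUt0.mul .rfl)).trans (setIntegral_mul_expKernel hsupp hτ.ne')
  rw [intervalIntegral.integral_sub ((hint a le_rfl τ).const_mul _) ((hint x hx τ).const_mul _),
    intervalIntegral.integral_const_mul, intervalIntegral.integral_const_mul, hinitial, hsource,
    hu0 a le_rfl] at hftc
  rw [echoAmplitude, terminalPotential_eq hτ (Lp.memLp _) (Lp.memLp _)]
  simp only [waveLaplace, neg_mul, mul_zero, Real.exp_zero] at hftc ⊢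
  field_simp
  linear_combination -hftc

end WeakSolution

/-- `h` is bounded at `+∞` by a power; such factors are absorbed by an exponentially small one. -/
def HasPolynomialGrowth (h : ℝ → ℝ) : Prop :=
  ∃ m : ℕ, h =O[atTop] fun τ => τ ^ m

section Growth

variable {g h : ℝ → ℝ}

lemma isBigO_pow_pow_atTop {m n : ℕ} (h : m ≤ n) :
    (fun τ : ℝ => τ ^ m) =O[atTop] fun τ => τ ^ n := by
  refine IsBigO.of_bound' ?_
  filter_upwards [eventually_ge_atTop 1] with τ hτ
  rw [norm_pow, norm_pow, Real.norm_of_nonneg (by positivity)]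
  exact pow_le_pow_right₀ hτ h

lemma hasPolynomialGrowth_of_isBigO_one (hh : h =O[atTop] fun _ => (1 : ℝ)) :
    HasPolynomialGrowth h :=
  ⟨0, by simpa only [pow_zero] using hh⟩

lemma hasPolynomialGrowth_const (c : ℝ) : HasPolynomialGrowth fun _ => c :=
  hasPolynomialGrowth_of_isBigO_one (isBigO_const_const c one_ne_zero _)

lemma hasPolynomialGrowth_id : HasPolynomialGrowth fun τ => τ :=
  ⟨1, by simpa only [pow_one] using isBigO_refl _ _⟩

lemma hasPolynomialGrowth_one_div_mul (c : ℝ) : HasPolynomialGrowth fun τ => 1 / (c * τ) :=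
  hasPolynomialGrowth_of_isBigO_one <| by
    simpa [mul_comm] using (tendsto_inv_atTop_zero.isBigO_one ℝ).const_mul_left c⁻¹

lemma hasPolynomialGrowth_exp_neg_mul {c : ℝ} (hc : 0 ≤ c) :
    HasPolynomialGrowth fun τ => Real.exp (-τ * c) := by
  refine hasPolynomialGrowth_of_isBigO_one (IsBigO.of_bound 1 ?_)
  filter_upwards [eventually_ge_atTop 0] with τ hτ
  rw [norm_one, mul_one, Real.norm_eq_abs, Real.abs_exp, Real.exp_le_one_iff, neg_mul]
  exact neg_nonpos.2 (mul_nonneg hτ hc)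

namespace HasPolynomialGrowth

lemma of_isBigO (hg : HasPolynomialGrowth g) (hh : h =O[atTop] g) : HasPolynomialGrowth h :=
  hg.imp fun _ => hh.trans

lemma add (hg : HasPolynomialGrowth g) (hh : HasPolynomialGrowth h) :
    HasPolynomialGrowth fun τ => g τ + h τ := by
  obtain ⟨m, hm⟩ := hg
  obtain ⟨n, hn⟩ := hh
  exact ⟨max m n, (hm.trans (isBigO_pow_pow_atTop (le_max_left m n))).add
    (hn.trans (isBigO_pow_pow_atTop (le_max_right m n)))⟩

lemma mul (hg : HasPolynomialGrowth g) (hh : HasPolynomialGrowth h) :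
    HasPolynomialGrowth fun τ => g τ * h τ := by
  obtain ⟨m, hm⟩ := hg
  obtain ⟨n, hn⟩ := hh
  exact ⟨m + n, by simpa only [pow_add] using hm.mul hn⟩

lemma neg (hg : HasPolynomialGrowth g) : HasPolynomialGrowth fun τ => -g τ :=
  hg.of_isBigO (isBigO_refl g _).neg_left

lemma sub (hg : HasPolynomialGrowth g) (hh : HasPolynomialGrowth h) :
    HasPolynomialGrowth fun τ => g τ - h τ := by
  simpa only [sub_eq_add_neg] using hg.add hh.neg

lemma isBigO_exp_mul (hh : HasPolynomialGrowth h) {δ : ℝ} (hδ : 0 < δ) (N : ℕ) :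
    (fun τ => Real.exp (-δ * τ) * h τ) =O[atTop] fun τ => 1 / τ ^ N := by
  obtain ⟨m, hm⟩ := hh
  refine ((isLittleO_exp_neg_mul_rpow_atTop hδ (-(N + m : ℕ))).isBigO.mul hm).congr' .rfl ?_
  filter_upwards [eventually_gt_atTop 0] with τ hτ
  rw [Real.rpow_neg hτ.le, Real.rpow_natCast, pow_add, mul_inv, mul_assoc,
    inv_mul_cancel₀ (by positivity), mul_one, one_div]

end HasPolynomialGrowth

end Growth

namespace HasAsymptoticExpansion

variable {F G r : ℝ → ℝ} {c : ℕ → ℝ}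

lemma congr' (hF : HasAsymptoticExpansion F c) (h : F =ᶠ[atTop] G) :
    HasAsymptoticExpansion G c := fun N =>
  (hF N).congr' (h.sub .rfl) .rfl

lemma isBigO_one (hF : HasAsymptoticExpansion F c) : F =O[atTop] fun _ => (1 : ℝ) := by
  simpa using hF 0

lemma const_mul (hF : HasAsymptoticExpansion F c) (k : ℝ) :
    HasAsymptoticExpansion (fun τ => k * F τ) fun n => k * c n := fun N => by
  simpa only [mul_sub, Finset.mul_sum, mul_div_assoc] using (hF N).const_mul_left k

lemma const_add_div (hF : HasAsymptoticExpansion F fun n => c (n + 1)) :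
    HasAsymptoticExpansion (fun τ => c 0 + F τ / τ) c := by
  rintro (_ | N)
  · have hinv : (fun τ : ℝ => τ⁻¹) =O[atTop] fun _ => (1 : ℝ) :=
      tendsto_inv_atTop_zero.isBigO_one ℝ
    have hdiv : (fun τ => F τ / τ) =O[atTop] fun _ => (1 : ℝ) := by
      simpa only [div_eq_mul_inv, one_mul] using hF.isBigO_one.mul hinv
    simpa using (isBigO_const_const (c 0) one_ne_zero atTop).add hdiv
  · refine ((hF N).mul (isBigO_refl (fun τ => 1 / τ) atTop)).congr (fun τ => ?_) fun τ => ?_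
    · have hsum : ∑ k ∈ Finset.range N, c (k + 1) / τ ^ (k + 1) =
          (∑ k ∈ Finset.range N, c (k + 1) / τ ^ k) * (1 / τ) := by
        simp only [Finset.sum_mul, div_mul_div_comm, mul_one, pow_succ]
      rw [Finset.sum_range_succ', hsum]
      ring
    · rw [pow_succ, one_div_mul_one_div]

lemma add_exp_mul (hF : HasAsymptoticExpansion F c) {δ : ℝ} (hδ : 0 < δ)
    (hr : HasPolynomialGrowth r) :
    HasAsymptoticExpansion (fun τ => F τ + Real.exp (-δ * τ) * r τ) c := fun N =>
  ((hF N).add (hr.isBigO_exp_mul hδ N)).congr_left fun τ => by ring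

lemma tendsto (hF : HasAsymptoticExpansion F c) (N : ℕ) :
    Tendsto (fun τ => τ ^ N * (F τ - ∑ k ∈ Finset.range N, c k / τ ^ k)) atTop (𝓝 (c N)) := by
  have hdecay : (fun τ => τ ^ N * (F τ - ∑ k ∈ Finset.range (N + 1), c k / τ ^ k)) =O[atTop]
      fun τ => τ⁻¹ := by
    refine ((isBigO_refl (fun τ => τ ^ N) atTop).mul (hF (N + 1))).congr' .rfl ?_
    filter_upwards [eventually_gt_atTop 0] with τ hτ
    rw [pow_succ]
    field_simp
  refine (zero_add (c N) ▸ (hdecay.trans_tendsto tendsto_inv_atTop_zero).add_const (c N)).congr' ?_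
  filter_upwards [eventually_gt_atTop 0] with τ hτ
  rw [Finset.sum_range_succ]
  field_simp
  ring

lemma recoversParameters {γ β : ℝ} (hγ : γ ≠ -1)
    (hF : HasAsymptoticExpansion F (expansionCoeff γ β)) : RecoversParameters F γ β := by
  have hγ' : γ + 1 ≠ 0 := fun h => hγ (by linarith)
  have hc₁ : 1 + 2 * expansionCoeff γ β 1 = 2 / (γ + 1) := by
    simp only [expansionCoeff]
    field_simp
    ring
  refine ⟨expansionCoeff γ β 1, expansionCoeff γ β 2, ?_, ?_, ?_, ?_, ?_⟩
  · simpa [expansionCoeff] using hF.tendsto 1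
  · simpa [Finset.sum_range_succ, expansionCoeff] using hF.tendsto 2
  · rw [hc₁]
    positivity
  · rw [hc₁]
    simp only [expansionCoeff]
    field_simp
    ring
  · simp only [expansionCoeff]
    field_simp

end HasAsymptoticExpansion

lemma hasAsymptoticExpansion_one_div_one_sub_div (q : ℝ) :
    HasAsymptoticExpansion (fun τ => 1 / (1 - q / τ)) fun n => q ^ n := by
  have hlim : Tendsto (fun τ => 1 - q / τ) atTop (𝓝 1) := by
    simpa using (tendsto_const_nhds (x := q).div_atTop tendsto_id).const_sub 1
  intro N
  have hinv : (fun τ => (1 - q / τ)⁻¹) =O[atTop] fun _ => (1 : ℝ) :=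
    (hlim.inv₀ one_ne_zero).isBigO_one ℝ
  refine ((hinv.const_mul_left (q ^ N)).mul (isBigO_refl (fun τ => 1 / τ ^ N) atTop)).congr' ?_
    (.of_forall fun τ => one_mul _)
  filter_upwards [hlim.eventually_ne one_ne_zero] with τ hτ
  have hgeom := mul_neg_geom_sum (q / τ) N
  simp only [div_pow] at hgeom
  field_simp at hgeom ⊢
  linear_combination hgeom

/-- The reflection coefficient of the boundary condition at `a` at the frequency `τ`. -/
noncomputable def reflectionCoeff (γ β τ : ℝ) : ℝ := ((1 - γ) * τ - β) / ((1 + γ) * τ + β)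

section Reflection

variable {γ : ℝ}

lemma eventually_one_add_mul_add_ne_zero (hγ : γ ≠ -1) (β : ℝ) :
    ∀ᶠ τ in atTop, (1 + γ) * τ + β ≠ 0 := by
  filter_upwards [eventually_gt_atTop (-β / (1 + γ))] with τ hτ h
  have hγ' : 1 + γ ≠ 0 := fun h => hγ (by linarith)
  exact hτ.ne (by field_simp; linarith)

lemma hasAsymptoticExpansion_reflectionCoeff (hγ : γ ≠ -1) (β : ℝ) :
    HasAsymptoticExpansion (fun τ => reflectionCoeff γ β τ / (2 * τ)) (expansionCoeff γ β) := by
  have hgeom := (hasAsymptoticExpansion_one_div_one_sub_div (-β / (γ + 1))).const_mul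
    (-(β / (γ + 1) ^ 2))
  have hone : HasAsymptoticExpansion _ fun n => expansionCoeff γ β (n + 1) := hgeom.const_add_div
  refine hone.const_add_div.congr' ?_
  filter_upwards [eventually_gt_atTop 0, eventually_one_add_mul_add_ne_zero hγ β] with τ hτ hne
  have hγ' : γ + 1 ≠ 0 := fun h => hγ (by linarith)
  have hden : 1 - -β / (γ + 1) / τ = ((1 + γ) * τ + β) / ((γ + 1) * τ) := by
    field_simp
    ring
  rw [hden, reflectionCoeff]
  simp only [expansionCoeff]
  field_simp
  ring

lemma hasPolynomialGrowth_reflectionCoeff (hγ : γ ≠ -1) (β : ℝ) :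
    HasPolynomialGrowth (reflectionCoeff γ β) := by
  have hbounded := (hasAsymptoticExpansion_reflectionCoeff hγ β).isBigO_one
  refine (((hasPolynomialGrowth_const 2).mul hasPolynomialGrowth_id).mul
    (hasPolynomialGrowth_of_isBigO_one hbounded)).of_isBigO (EventuallyEq.isBigO ?_)
  filter_upwards [eventually_gt_atTop 0] with τ hτ
  field_simp

end Reflection

lemma setDist_Ioi_Icc {x r s : ℝ} (hrs : r ≤ s) (hsx : s ≤ x) :
    setDist (Ioi x) (Icc r s) = x - s := by
  refine IsGLB.csInf_eq ⟨?_, fun m hm => ?_⟩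
    ⟨_, x + 1, mem_Ioi.2 (lt_add_one x), s, right_mem_Icc.2 hrs, rfl⟩
  · rintro _ ⟨y, hy, z, hz, rfl⟩
    exact (sub_le_sub (le_of_lt hy) hz.2).trans (le_abs_self _)
  · refine le_of_forall_pos_le_add fun δ hδ => ?_
    have hmδ := hm ⟨x + δ, mem_Ioi.2 (lt_add_of_pos_right x hδ), s, right_mem_Icc.2 hrs, rfl⟩
    rw [Real.dist_eq, abs_of_nonneg (by linarith)] at hmδ
    linarith

section Source

variable {a b ε τ x : ℝ} {f : ℝ → ℝ}

lemma sourceIntegral_eq_setIntegral (hε : 0 ≤ ε) :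
    sourceIntegral b ε f τ = ∫ y in sourceB b ε, Real.exp (-τ * (b - y)) * f y := by
  rw [sourceIntegral, intervalIntegral.integral_of_le (by linarith), sourceB,
    integral_Icc_eq_integral_Ioc]

lemma integral_sourceB_mul_expKernel (hε : 0 ≤ ε) (hx : b ≤ x) :
    ∫ y in sourceB b ε, f y * expKernel τ x y =
      Real.exp (-τ * (x - b)) * sourceIntegral b ε f τ := by
  rw [sourceIntegral_eq_setIntegral hε, ← integral_const_mul]
  refine setIntegral_congr_fun measurableSet_Icc fun y hy => ?_
  rw [expKernel_of_le (hy.2.trans hx), ← mul_assoc, ← Real.exp_add, mul_comm]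
  ring_nf

lemma freeField_eq_sourceIntegral (hε : 0 ≤ ε) (hsupp : ∀ᵐ y, y ∉ sourceB b ε → f y = 0)
    (hτ : τ ≠ 0) (hx : b ≤ x) :
    freeField f x τ = 1 / (2 * τ) * (Real.exp (-τ * (x - b)) * sourceIntegral b ε f τ) := by
  rw [← integral_sourceB_mul_expKernel hε hx, setIntegral_mul_expKernel hsupp hτ]
  field_simp

lemma hasDerivAt_freeField (hε : 0 ≤ ε) (hsupp : ∀ᵐ y, y ∉ sourceB b ε → f y = 0)
    (hτ : τ ≠ 0) (hx : b < x) :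
    HasDerivAt (fun x => freeField f x τ) (-τ * freeField f x τ) x := by
  have hexp : HasDerivAt (fun x => Real.exp (-τ * (x - b)))
      (Real.exp (-τ * (x - b)) * (-τ * 1)) x :=
    (((hasDerivAt_id x).sub_const b).const_mul (-τ)).exp
  refine (((hexp.mul_const (sourceIntegral b ε f τ)).const_mul (1 / (2 * τ))).congr_of_eventuallyEq
    ?_).congr_deriv ?_
  · filter_upwards [Ioi_mem_nhds hx] with z hz
    exact freeField_eq_sourceIntegral hε hsupp hτ (le_of_lt hz)
  · rw [freeField_eq_sourceIntegral hε hsupp hτ hx.le]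
    ring

lemma hasPolynomialGrowth_sourceIntegral (hε : 0 ≤ ε) (hf : IntegrableOn f (sourceB b ε)) :
    HasPolynomialGrowth (sourceIntegral b ε f) := by
  refine hasPolynomialGrowth_of_isBigO_one
    (IsBigO.of_bound (∫ y in sourceB b ε, |f y|) ?_)
  filter_upwards [eventually_ge_atTop 0] with τ hτ
  rw [norm_one, mul_one, sourceIntegral_eq_setIntegral hε]
  refine norm_integral_le_of_norm_le hf.abs ?_
  filter_upwards [ae_restrict_mem measurableSet_Icc] with y hy
  rw [norm_mul, Real.norm_eq_abs, Real.abs_exp]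
  refine mul_le_of_le_one_left (norm_nonneg _) (Real.exp_le_one_iff.2 ?_)
  exact mul_nonpos_of_nonpos_of_nonneg (neg_nonpos.2 hτ) (sub_nonneg.2 hy.2)

namespace NonvanishingAtEndpoint

lemma exists_eventually_lt (h : NonvanishingAtEndpoint b ε f) :
    ∃ c > 0, ∃ μ : ℝ, ∀ᶠ τ in atTop, c < τ ^ μ * |sourceIntegral b ε f τ| := by
  obtain ⟨μ, hμ⟩ := h
  obtain ⟨c, hc, hcμ⟩ := ENNReal.lt_iff_exists_nnreal_btwn.1 hμ
  refine ⟨c, by exact_mod_cast hc, μ, ?_⟩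
  filter_upwards [eventually_lt_of_lt_liminf hcμ] with τ hτ
  exact (ENNReal.lt_ofReal_iff_toReal_lt ENNReal.coe_ne_top).1 hτ

lemma eventually_ne_zero (h : NonvanishingAtEndpoint b ε f) :
    ∀ᶠ τ in atTop, sourceIntegral b ε f τ ≠ 0 := by
  obtain ⟨c, hc, μ, hμ⟩ := h.exists_eventually_lt
  filter_upwards [hμ] with τ hτ hzero
  rw [hzero, abs_zero, mul_zero] at hτ
  exact hτ.not_gt hc

lemma hasPolynomialGrowth_inv (h : NonvanishingAtEndpoint b ε f) :
    HasPolynomialGrowth fun τ => (sourceIntegral b ε f τ)⁻¹ := by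
  obtain ⟨c, hc, μ, hμ⟩ := h.exists_eventually_lt
  refine ⟨⌈μ⌉₊, IsBigO.of_bound c⁻¹ ?_⟩
  filter_upwards [hμ, h.eventually_ne_zero, eventually_ge_atTop 1] with τ hτ hS hτ1
  have hpow : τ ^ μ ≤ τ ^ ⌈μ⌉₊ := by
    rw [← Real.rpow_natCast]
    exact Real.rpow_le_rpow_of_exponent_le hτ1 (Nat.le_ceil μ)
  rw [norm_inv, Real.norm_eq_abs, Real.norm_of_nonneg (by positivity), inv_mul_eq_div,
    inv_le_iff_one_le_mul₀ (abs_pos.2 hS), div_mul_eq_mul_div, le_div_iff₀ hc, one_mul]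
  exact hτ.le.trans (mul_le_mul_of_nonneg_right hpow (abs_nonneg _))

end NonvanishingAtEndpoint

lemma hasAsymptoticExpansion_normalized {G J r : ℝ → ℝ} {c : ℕ → ℝ} {d : ℝ} (hε : 0 ≤ ε)
    (hba : b ≤ a) (hnv : NonvanishingAtEndpoint b ε f) (hG : HasAsymptoticExpansion G c)
    (hr : HasPolynomialGrowth r) (hd : 2 * (a - b) < d)
    (hJ : ∀ᶠ τ in atTop, J τ = G τ * (Real.exp (-τ * (a - b)) * sourceIntegral b ε f τ) ^ 2 +
      Real.exp (-τ * d) * r τ) :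
    HasAsymptoticExpansion (normalized a b ε f J) c := by
  have hS := hnv.hasPolynomialGrowth_inv
  refine (hG.add_exp_mul (sub_pos.2 hd) (hr.mul (hS.mul hS))).congr' ?_
  filter_upwards [hJ, hnv.eventually_ne_zero] with τ hτ hSτ
  have hmain : Real.exp (2 * τ * (a - b)) * Real.exp (-τ * (a - b)) ^ 2 = 1 := by
    rw [← Real.exp_nat_mul, ← Real.exp_add, Real.exp_eq_one_iff]
    push_cast
    ring
  have herror : Real.exp (-(d - 2 * (a - b)) * τ) =
      Real.exp (2 * τ * (a - b)) * Real.exp (-τ * d) := by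
    rw [← Real.exp_add]
    ring_nf
  rw [normalized, obstacle, sourceB, setDist_Ioi_Icc (by linarith) hba, sq_abs, hτ, herror]
  simp only [neg_mul] at hmain ⊢
  field_simp
  linear_combination (-G τ * sourceIntegral b ε f τ ^ 2) * hmain

end Source

section TerminalState

variable {a b ε τ x : ℝ} {f p q : ℝ → ℝ}

/-- The derivative of `terminalPotential` with respect to the observation point `x`. -/
noncomputable def terminalPotentialDeriv (a : ℝ) (p q : ℝ → ℝ) (τ x : ℝ) : ℝ :=
  -∫ y in Iio a, (p y + τ * q y) * expKernelDeriv τ x y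

lemma hasDerivAt_terminalPotential (hτ : 0 < τ) (hp : MemLp p 2 (halfLineMeasure a))
    (hq : MemLp q 2 (halfLineMeasure a)) (x : ℝ) :
    HasDerivAt (terminalPotential a p q τ) (terminalPotentialDeriv a p q τ x) x :=
  hasDerivAt_integral_mul_expKernel hτ.le (hp.add (hq.const_mul τ)).1
    (integrable_mul_expKernel hτ (hp.add (hq.const_mul τ)))

lemma continuous_terminalPotential (hτ : 0 < τ) (hp : MemLp p 2 (halfLineMeasure a))
    (hq : MemLp q 2 (halfLineMeasure a)) : Continuous (terminalPotential a p q τ) :=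
  continuous_iff_continuousAt.2 fun x => (hasDerivAt_terminalPotential hτ hp hq x).continuousAt

lemma exists_integral_abs_mul_expKernel_le (hp : MemLp p 2 (halfLineMeasure a))
    (hq : MemLp q 2 (halfLineMeasure a)) (r : ℝ) :
    ∃ C, ∀ τ ≥ 1, ∀ x, |x| ≤ r →
      ∫ y in Iio a, |p y + τ * q y| * expKernel τ x y ≤ C * τ := by
  have hint := integrable_mul_expKernel (x := 0) one_pos (hp.abs.add hq.abs)
  refine ⟨Real.exp r * ∫ y in Iio a, (|p y| + |q y|) * expKernel 1 0 y, fun τ hτ x hx => ?_⟩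
  have hkernel : ∀ y, expKernel τ x y ≤ Real.exp r * expKernel 1 0 y := fun y =>
    calc expKernel τ x y ≤ expKernel 1 x y := expKernel_antitone hτ
      _ ≤ Real.exp (1 * |x - 0|) * expKernel 1 0 y := expKernel_le_exp_mul zero_le_one
      _ ≤ Real.exp r * expKernel 1 0 y := by
        rw [one_mul, sub_zero]
        exact mul_le_mul_of_nonneg_right (Real.exp_le_exp.2 hx) expKernel_pos.le
  have hdensity : ∀ y, |p y + τ * q y| ≤ τ * (|p y| + |q y|) := fun y =>
    calc |p y + τ * q y| ≤ |p y| + τ * |q y| := by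
          simpa [abs_mul, abs_of_pos (one_pos.trans_le hτ)] using abs_add_le (p y) (τ * q y)
      _ ≤ τ * (|p y| + |q y|) := by nlinarith [abs_nonneg (p y)]
  rw [mul_right_comm, ← integral_const_mul]
  refine integral_mono_of_nonneg (.of_forall fun y => mul_nonneg (abs_nonneg _) expKernel_pos.le)
    (hint.const_mul _) (.of_forall fun y => ?_)
  calc |p y + τ * q y| * expKernel τ x y
      ≤ τ * (|p y| + |q y|) * (Real.exp r * expKernel 1 0 y) :=
        mul_le_mul (hdensity y) (hkernel y) expKernel_pos.le (by positivity)
    _ = Real.exp r * τ * ((|p y| + |q y|) * expKernel 1 0 y) := by ring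

lemma exists_abs_terminalPotential_le (hp : MemLp p 2 (halfLineMeasure a))
    (hq : MemLp q 2 (halfLineMeasure a)) (r : ℝ) :
    ∃ C, ∀ τ ≥ 1, ∀ x, |x| ≤ r → |terminalPotential a p q τ x| ≤ C * τ := by
  obtain ⟨C, hC⟩ := exists_integral_abs_mul_expKernel_le hp hq r
  refine ⟨C, fun τ hτ x hx => abs_integral_le_integral_abs.trans ?_⟩
  simpa only [abs_mul, abs_of_pos expKernel_pos] using hC τ hτ x hx

lemma hasPolynomialGrowth_terminalPotential (hp : MemLp p 2 (halfLineMeasure a))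
    (hq : MemLp q 2 (halfLineMeasure a)) (x : ℝ) :
    HasPolynomialGrowth fun τ => terminalPotential a p q τ x := by
  obtain ⟨C, hC⟩ := exists_abs_terminalPotential_le hp hq |x|
  refine hasPolynomialGrowth_id.of_isBigO (IsBigO.of_bound C ?_)
  filter_upwards [eventually_ge_atTop 1] with τ hτ
  rw [Real.norm_of_nonneg (zero_le_one.trans hτ)]
  exact hC τ hτ x le_rfl

lemma hasPolynomialGrowth_terminalPotentialDeriv (hp : MemLp p 2 (halfLineMeasure a))
    (hq : MemLp q 2 (halfLineMeasure a)) (x : ℝ) :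
    HasPolynomialGrowth fun τ => terminalPotentialDeriv a p q τ x := by
  obtain ⟨C, hC⟩ := exists_integral_abs_mul_expKernel_le hp hq |x|
  refine (hasPolynomialGrowth_id.mul hasPolynomialGrowth_id).of_isBigO (IsBigO.of_bound C ?_)
  filter_upwards [eventually_ge_atTop 1] with τ hτ
  have hτ0 : 0 < τ := one_pos.trans_le hτ
  have hint := integrable_mul_expKernel (x := x) hτ0 (hp.add (hq.const_mul τ)).abs
  calc ‖terminalPotentialDeriv a p q τ x‖
      ≤ ∫ y in Iio a, τ * (|p y + τ * q y| * expKernel τ x y) := by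
        rw [terminalPotentialDeriv, norm_neg]
        refine norm_integral_le_of_norm_le (hint.const_mul τ) (.of_forall fun y => ?_)
        rw [norm_mul, ← mul_left_comm]
        exact mul_le_mul_of_nonneg_left (abs_expKernelDeriv_le hτ0.le) (abs_nonneg _)
    _ ≤ τ * (C * τ) := by
        rw [integral_const_mul]
        exact mul_le_mul_of_nonneg_left (hC τ hτ x le_rfl) hτ0.le
    _ = C * ‖τ * τ‖ := by
        rw [Real.norm_of_nonneg (by positivity)]
        ring

lemma hasPolynomialGrowth_integral_mul_terminalPotential (hf : IntegrableOn f (sourceB b ε))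
    (hp : MemLp p 2 (halfLineMeasure a)) (hq : MemLp q 2 (halfLineMeasure a)) :
    HasPolynomialGrowth fun τ => ∫ y in sourceB b ε, f y * terminalPotential a p q τ y := by
  obtain ⟨C, hC⟩ := exists_abs_terminalPotential_le hp hq (max |b - ε| |b|)
  refine hasPolynomialGrowth_id.of_isBigO (IsBigO.of_bound (C * ∫ y in sourceB b ε, |f y|) ?_)
  filter_upwards [eventually_ge_atTop 1] with τ hτ
  rw [Real.norm_of_nonneg (zero_le_one.trans hτ), mul_right_comm, ← integral_const_mul]
  refine norm_integral_le_of_norm_le (hf.abs.const_mul _) ?_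
  filter_upwards [ae_restrict_mem measurableSet_Icc] with y hy
  rw [norm_mul, mul_comm]
  exact mul_le_mul_of_nonneg_right (hC τ hτ y (abs_le_max_abs_abs hy.1 hy.2)) (abs_nonneg _)

end TerminalState

section Scattering

variable {a b ε T γ β τ x : ℝ} {f p q : ℝ → ℝ} {u : ℝ → ℝ → ℝ}

/-- The part of `echoAmplitude` left behind by cutting the Laplace transform off at `T`, without
its factor `e^{-τT}`. -/
noncomputable def echoRemainder (a T γ β : ℝ) (u : ℝ → ℝ → ℝ) (p q : ℝ → ℝ) (τ : ℝ) : ℝ :=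
  -(reflectionCoeff γ β τ * (terminalPotential a p q τ a + γ * u a T) + γ * u a T)

lemma hasPolynomialGrowth_echoRemainder (hγ : γ ≠ -1) (hp : MemLp p 2 (halfLineMeasure a))
    (hq : MemLp q 2 (halfLineMeasure a)) : HasPolynomialGrowth (echoRemainder a T γ β u p q) :=
  (((hasPolynomialGrowth_reflectionCoeff hγ β).mul
    ((hasPolynomialGrowth_terminalPotential hp hq a).add (hasPolynomialGrowth_const _))).add
      (hasPolynomialGrowth_const _)).neg

namespace HasScatteredField

lemma echoAmplitude_eq (h : HasScatteredField a T γ β f u p q) (hε : 0 ≤ ε) (hba : b ≤ a)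
    (hsupp : ∀ᵐ y, y ∉ sourceB b ε → f y = 0) (hτ : 0 < τ) (hne : (1 + γ) * τ + β ≠ 0) :
    echoAmplitude a T γ β u τ =
      reflectionCoeff γ β τ * (Real.exp (-τ * (a - b)) * sourceIntegral b ε f τ) +
        Real.exp (-τ * T) * echoRemainder a T γ β u p q τ := by
  have htrace := h.waveLaplace_eq τ hτ a le_rfl
  rw [expKernel_self, freeField_eq_sourceIntegral hε hsupp hτ.ne' hba, echoAmplitude] at htrace
  have hw : waveLaplace T u a τ = (Real.exp (-τ * (a - b)) * sourceIntegral b ε f τ -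
      Real.exp (-τ * T) * (terminalPotential a p q τ a + γ * u a T)) / ((1 + γ) * τ + β) := by
    rw [eq_div_iff hne]
    simp only [neg_mul] at htrace ⊢
    field_simp at htrace
    linear_combination htrace
  rw [echoAmplitude, echoRemainder, reflectionCoeff, hw]
  ring

lemma hasDerivAt_waveLaplace (h : HasScatteredField a T γ β f u p q) (hε : 0 ≤ ε)
    (hsupp : ∀ᵐ y, y ∉ sourceB b ε → f y = 0) (hτ : 0 < τ) (hbx : b < x) (hxa : x < a) :
    HasDerivAt (fun x => waveLaplace T u x τ) (-τ * freeField f x τ +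
      1 / (2 * τ) * (echoAmplitude a T γ β u τ * (τ * expKernel τ x a) -
        Real.exp (-τ * T) * terminalPotentialDeriv a p q τ x)) x := by
  have hkernel : HasDerivAt (fun x => expKernel τ x a) (τ * expKernel τ x a) x := by
    simpa [expKernel_comm (y := a), expKernelDeriv, sub_pos.2 hxa] using
      hasDerivAt_expKernel (τ := τ) hxa.ne
  have hpotential := hasDerivAt_terminalPotential hτ h.memLp_velocity h.memLp_position x
  refine ((hasDerivAt_freeField hε hsupp hτ.ne' hbx).add (((hkernel.const_mul _).sub
    (hpotential.const_mul _)).const_mul _)).congr_of_eventuallyEq ?_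
  filter_upwards [Iio_mem_nhds hxa] with z hz
  exact h.waveLaplace_eq τ hτ z (le_of_lt hz)

-- The scattered field adds to `w` an echo `e^{τx}`, and `v` is a multiple of `e^{-τx}` right of
-- the source, so that the Wronskian of `v` and `w` picks out the echo.
lemma indicatorI_eq (h : HasScatteredField a T γ β f u p q) (hε : 0 ≤ ε)
    (hsupp : ∀ᵐ y, y ∉ sourceB b ε → f y = 0) (hτ : 0 < τ) (hb : b < 0) (ha : 0 < a) :
    indicatorI T f u τ = freeField f 0 τ * (echoAmplitude a T γ β u τ * Real.exp (-τ * a) -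
      Real.exp (-τ * T) * (1 / (2 * τ) *
        (terminalPotentialDeriv a p q τ 0 + τ * terminalPotential a p q τ 0))) := by
  rw [indicatorI, (hasDerivAt_freeField hε hsupp hτ.ne' hb).deriv,
    (h.hasDerivAt_waveLaplace hε hsupp hτ hb ha).deriv, h.waveLaplace_eq τ hτ 0 ha.le,
    expKernel_of_ge ha.le, sub_zero]
  field_simp
  ring

lemma waveLaplace_sub_freeField (h : HasScatteredField a T γ β f u p q) (hτ : 0 < τ)
    (hx : x ≤ a) :
    waveLaplace T u x τ - freeField f x τ = 1 / (2 * τ) * (echoAmplitude a T γ β u τ *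
      expKernel τ a x - Real.exp (-τ * T) * terminalPotential a p q τ x) := by
  rw [h.waveLaplace_eq τ hτ x hx, add_sub_cancel_left, expKernel_comm]

lemma continuousOn_waveLaplace_sub_freeField (h : HasScatteredField a T γ β f u p q)
    (hτ : 0 < τ) : ContinuousOn (fun x => waveLaplace T u x τ - freeField f x τ) (Iic a) := by
  have hpotential := continuous_terminalPotential hτ h.memLp_velocity h.memLp_position
  exact (((continuous_expKernel.const_mul _).sub (hpotential.const_mul _)).const_mul
    _).continuousOn.congr fun x hx => h.waveLaplace_sub_freeField hτ hx

lemma backScattering_eq (h : HasScatteredField a T γ β f u p q) (hε : 0 ≤ ε) (hba : b ≤ a)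
    (hf : IntegrableOn f (sourceB b ε)) (hτ : 0 < τ) :
    backScattering b ε T f u τ = 1 / (2 * τ) *
      (echoAmplitude a T γ β u τ * (Real.exp (-τ * (a - b)) * sourceIntegral b ε f τ) -
        Real.exp (-τ * T) * ∫ y in sourceB b ε, f y * terminalPotential a p q τ y) := by
  have hkernel : IntegrableOn (fun y => f y * expKernel τ a y) (sourceB b ε) :=
    hf.mul_continuousOn continuous_expKernel.continuousOn isCompact_Icc
  have hpotential : IntegrableOn (fun y => f y * terminalPotential a p q τ y) (sourceB b ε) :=
    hf.mul_continuousOn (continuous_terminalPotential hτ h.memLp_velocity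
      h.memLp_position).continuousOn isCompact_Icc
  rw [← integral_sourceB_mul_expKernel hε hba, ← integral_const_mul, ← integral_const_mul,
    ← integral_sub (hkernel.const_mul _) (hpotential.const_mul _), ← integral_const_mul]
  refine setIntegral_congr_fun measurableSet_Icc fun y hy => ?_
  simp only [h.waveLaplace_sub_freeField hτ (hy.2.trans hba)]
  ring

lemma hasAsymptoticExpansion_indicatorI (h : HasScatteredField a T γ β f u p q) (hε : 0 ≤ ε)
    (hγ : γ ≠ -1) (hf : IntegrableOn f (sourceB b ε))
    (hsupp : ∀ᵐ y, y ∉ sourceB b ε → f y = 0) (hnv : NonvanishingAtEndpoint b ε f)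
    (hb : b < 0) (ha : 0 < a) (hT : 2 * (a - b) < T - b) :
    HasAsymptoticExpansion (normalized a b ε f (indicatorI T f u)) (expansionCoeff γ β) := by
  have hinv := hasPolynomialGrowth_one_div_mul 2
  have hexp := hasPolynomialGrowth_exp_neg_mul ha.le
  have hpotential := (hasPolynomialGrowth_terminalPotentialDeriv h.memLp_velocity
    h.memLp_position 0).add (hasPolynomialGrowth_id.mul
      (hasPolynomialGrowth_terminalPotential h.memLp_velocity h.memLp_position 0))
  have hremainder := hasPolynomialGrowth_echoRemainder (T := T) (β := β) (u := u) hγ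
    h.memLp_velocity h.memLp_position
  refine hasAsymptoticExpansion_normalized hε (hb.trans ha).le hnv
    (hasAsymptoticExpansion_reflectionCoeff hγ β)
    ((hinv.mul (hasPolynomialGrowth_sourceIntegral hε hf)).mul
      ((hremainder.mul hexp).sub (hinv.mul hpotential))) hT ?_
  filter_upwards [eventually_gt_atTop 0, eventually_one_add_mul_add_ne_zero hγ β] with τ hτ hne
  have hmain : Real.exp (-τ * (0 - b)) * Real.exp (-τ * a) = Real.exp (-τ * (a - b)) := by
    rw [← Real.exp_add]
    ring_nf
  have herror : Real.exp (-τ * (T - b)) = Real.exp (-τ * (0 - b)) * Real.exp (-τ * T) := by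
    rw [← Real.exp_add]
    ring_nf
  rw [h.indicatorI_eq hε hsupp hτ hb ha, freeField_eq_sourceIntegral hε hsupp hτ.ne' hb.le,
    h.echoAmplitude_eq hε (hb.trans ha).le hsupp hτ hne, herror, ← hmain]
  ring

lemma hasAsymptoticExpansion_backScattering (h : HasScatteredField a T γ β f u p q)
    (hε : 0 ≤ ε) (hba : b ≤ a) (hγ : γ ≠ -1) (hf : IntegrableOn f (sourceB b ε))
    (hsupp : ∀ᵐ y, y ∉ sourceB b ε → f y = 0) (hnv : NonvanishingAtEndpoint b ε f)
    (hT : 2 * (a - b) < T) :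
    HasAsymptoticExpansion (normalized a b ε f (backScattering b ε T f u))
      (expansionCoeff γ β) := by
  have hinv := hasPolynomialGrowth_one_div_mul 2
  have hexp := hasPolynomialGrowth_exp_neg_mul (sub_nonneg.2 hba)
  have hremainder := hasPolynomialGrowth_echoRemainder (T := T) (β := β) (u := u) hγ
    h.memLp_velocity h.memLp_position
  refine hasAsymptoticExpansion_normalized hε hba hnv
    (hasAsymptoticExpansion_reflectionCoeff hγ β)
    (hinv.mul ((hremainder.mul (hexp.mul (hasPolynomialGrowth_sourceIntegral hε hf))).sub
      (hasPolynomialGrowth_integral_mul_terminalPotential hf h.memLp_velocity h.memLp_position)))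
    hT ?_
  filter_upwards [eventually_gt_atTop 0, eventually_one_add_mul_add_ne_zero hγ β] with τ hτ hne
  rw [h.backScattering_eq hε hba hf hτ, h.echoAmplitude_eq hε hba hsupp hτ hne]
  ring

end HasScatteredField

end Scattering

theorem theorem4p3_general (a b ε T γ β : ℝ) (ha : 0 < a) (hb : b < 0) (hε : 0 < ε) (hT : 0 < T)
    (hγ : γ ≠ -1) (f : ℝ → ℝ) (hf : MemLp f 2 volume)
    (hsupp : ∀ᵐ x, x ∉ sourceB b ε → f x = 0)
    (hnv : NonvanishingAtEndpoint b ε f)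
    (u : ℝ → ℝ → ℝ) (hu : IsWeakSolution a T γ β f u) :
    (∀ τ : ℝ, 0 < τ →
      (∀ x ≤ a, IntervalIntegrable (fun t => Real.exp (-τ * t) * u x t) volume 0 T) ∧
      DifferentiableAt ℝ (fun x => waveLaplace T u x τ) 0 ∧
      DifferentiableAt ℝ (fun x => freeField f x τ) 0 ∧
      IntegrableOn (fun y => f y * (waveLaplace T u y τ - freeField f y τ)) (sourceB b ε)) ∧
    (2 * setDist (obstacle a) (sourceB b ε) - setDist domainOmega (sourceB b ε) < T →
      HasAsymptoticExpansion (normalized a b ε f (indicatorI T f u)) (expansionCoeff γ β) ∧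
      RecoversParameters (normalized a b ε f (indicatorI T f u)) γ β) ∧
    (2 * setDist (obstacle a) (sourceB b ε) < T →
      HasAsymptoticExpansion (normalized a b ε f (backScattering b ε T f u))
        (expansionCoeff γ β) ∧
      RecoversParameters (normalized a b ε f (backScattering b ε T f u)) γ β) := by
  have hba : b ≤ a := (hb.trans ha).le
  have hfB : IntegrableOn f (sourceB b ε) :=
    (hf.locallyIntegrable one_le_two).integrableOn_isCompact isCompact_Icc
  obtain ⟨p, q, h⟩ := hu.exists_hasScatteredField hT.le <| by
    filter_upwards [hsupp] with y hy hya
    exact hy fun hyB => hya (hyB.2.trans_lt (hb.trans ha))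
  have hD : setDist (obstacle a) (sourceB b ε) = a - b := setDist_Ioi_Icc (by linarith) hba
  have hΩ : setDist domainOmega (sourceB b ε) = 0 - b := setDist_Ioi_Icc (by linarith) hb.le
  rw [hD, hΩ]
  refine ⟨fun τ hτ => ⟨fun x hx => hu.intervalIntegrable hT.le hx,
    (h.hasDerivAt_waveLaplace hε.le hsupp hτ hb ha).differentiableAt,
    (hasDerivAt_freeField hε.le hsupp hτ.ne' hb).differentiableAt,
    hfB.mul_continuousOn ((h.continuousOn_waveLaplace_sub_freeField hτ).mono
      fun y hy => hy.2.trans hba) isCompact_Icc⟩, fun hT' => ?_, fun hT' => ?_⟩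
  · have hI := h.hasAsymptoticExpansion_indicatorI hε.le hγ hfB hsupp hnv hb ha (by linarith)
    exact ⟨hI, hI.recoversParameters hγ⟩
  · have hB := h.hasAsymptoticExpansion_backScattering hε.le hba hγ hfB hsupp hnv hT'
    exact ⟨hB, hB.recoversParameters hγ⟩

theorem theorem4p3 (a b ε T γ β : ℝ) (ha : 0 < a) (hb : b < 0) (hε : 0 < ε) (hT : 0 < T)
    (hγ : 0 ≤ γ) (f : ℝ → ℝ) (hf : MemLp f 2 volume)
    (hsupp : ∀ᵐ x, x ∉ sourceB b ε → f x = 0)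
    (hnv : NonvanishingAtEndpoint b ε f)
    (u : ℝ → ℝ → ℝ) (hu : IsWeakSolution a T γ β f u) :
    (∀ τ : ℝ, 0 < τ →
      (∀ x ≤ a, IntervalIntegrable (fun t => Real.exp (-τ * t) * u x t) volume 0 T) ∧
      DifferentiableAt ℝ (fun x => waveLaplace T u x τ) 0 ∧
      DifferentiableAt ℝ (fun x => freeField f x τ) 0 ∧
      IntegrableOn (fun y => f y * (waveLaplace T u y τ - freeField f y τ)) (sourceB b ε)) ∧
    (2 * setDist (obstacle a) (sourceB b ε) - setDist domainOmega (sourceB b ε) < T →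
      HasAsymptoticExpansion (normalized a b ε f (indicatorI T f u)) (expansionCoeff γ β) ∧
      RecoversParameters (normalized a b ε f (indicatorI T f u)) γ β) ∧
    (2 * setDist (obstacle a) (sourceB b ε) < T →
      HasAsymptoticExpansion (normalized a b ε f (backScattering b ε T f u))
        (expansionCoeff γ β) ∧
      RecoversParameters (normalized a b ε f (backScattering b ε T f u)) γ β) :=
  theorem4p3_general a b ε T γ β ha hb hε hT (by linarith) f hf hsupp hnv u hu
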